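/- Let $\mathcal K$ be a separable complex Hilbert space of finite or infinite dimension, and let $\rho,\sigma$ be states on $\mathcal K$ (positive operators of trace one) with spectral decompositions $\rho=\sum_{i} r_i|u_i\rangle\langle u_i|$, $\sigma=\sum_j s_j|v_j\rangle\langle v_j|$, where $\{u_i\}_{i\in\mathcal I}$ and $\{v_j\}_{j\in\mathcal I}$ are orthonormal bases of $\mathcal K$, $r_i,s_j\ge 0$ and $\sum_i r_i=\sum_j s_j=1$. Let $\alpha\in(0,1)\cup(1,\infty)$. For $\alpha<1$, $\sigma^{1-\alpha}$ is the usual power, with domain $D(\sigma^{1-\alpha})=\mathcal K$. For $\alpha>1$, $\sigma^{1-\alpha}$ is the pseudoinverse of $\sigma^{\alpha-1}$, i.e. the (possibly unbounded) inverse of the restriction of $\sigma^{\alpha-1}$ to $\operatorname{supp}\sigma=(\ker\sigma)^\perp$, with domain $D(\sigma^{1-\alpha})=\operatorname{ran}\sigma^{\alpha-1}\subseteq\operatorname{supp}\sigma$. The operator $\rho^{\alpha/2}\sigma^{1-\alpha}\rho^{\alpha/2}$ is defined initially on the linear span of the eigenvectors of $\rho$, provided that $\rho^{\alpha/2}x\in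 D(\sigma^{1-\alpha})$ for all $x$ in this span, and is then replaced by its Friedrichs extension. The trace of a positive selfadjoint operator $T$ is $\operatorname{Tr}T=\sum_k\langle w_k|T|w_k\rangle\in[0,\infty]$ for any orthonormal basis $\{w_k\}$ of $\mathcal K$ contained in $D(T)$. The Petz-Rényi $\alpha$-relative entropy is $$D_\alpha(\rho\|\sigma)=\frac1{\alpha-1}\log\operatorname{Tr}\rho^{\alpha/2}\sigma^{1-\alpha}\rho^{\alpha/2}\in[-\infty,\infty]$$ if $\rho^{\alpha/2}\sigma^{1-\alpha}\rho^{\alpha/2}$ is defined in this way as a positive selfadjoint operator, and $D_\alpha(\rho\|\sigma)=\infty$ otherwise. Here $\log 0=-\infty$ and $\log\infty=\infty$; below, $0^{p}=\infty$ for $p<0$ and $0\cdot\infty=0$. Put $$S=\sum_{i,j}r_i^{\alpha}s_j^{1-\alpha}|\langle u_i,v_j\rangle|^2\in[0,\infty].$$ Then, for every $i$, $u_i\in D(\sigma^{1-\alpha})$ if and only if $\sum_j s_j^{2(1-\alpha)}|\langle u_i,v_j\rangle|^2<\infty$. Consider the conditions 1. $u_i\in D(\sigma^{1-\alpha})$ for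 all $i$ with $r_i\neq0$; 2. $S<\infty$. The entropy $D_\alpha(\rho\|\sigma)$ is finite if and only if conditions 1 and 2 hold and $S\neq0$. If $\alpha>1$, then condition 1 already implies $S\neq 0$, so that in this case $D_\alpha(\rho\|\sigma)$ is finite if and only if conditions 1 and 2 hold. Moreover, whenever condition 1 holds, $$D_\alpha(\rho\|\sigma)=\frac{1}{\alpha-1}\log\sum_{i,j}r_i^{\alpha}s_j^{1-\alpha}|\langle u_i,v_j\rangle|^2 .$$ -/

import Mathlib

open scoped ENNReal InnerProductSpace

namespace PetzRenyi

section

variable {K : Type*} [NormedAddCommGroup K] [InnerProductSpace ℂ K]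

/-- `S` is (the set of members of) an orthonormal basis of `K` contained in the subspace `D`. -/
def IsOrthonormalBasisIn (D : Submodule ℂ K) (S : Set K) : Prop :=
  S ⊆ (D : Set K) ∧ Orthonormal ℂ (fun x : S => (x : K)) ∧
    (Submodule.span ℂ S).topologicalClosure = ⊤

open Classical in
/-- The trace `∑ ⟨x, T x⟩ ∈ [0, ∞]` of a positive operator `T`, the sum running over an
orthonormal basis of the space that is contained in the domain of `T`. For a positive selfadjoint
operator every choice of the orthonormal basis gives the same value. -/
noncomputable def trace (T : K →ₗ.[ℂ] K) : ℝ≥0∞ :=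
  if h : ∃ S : Set K, IsOrthonormalBasisIn T.domain S then
    ∑' x : h.choose, ENNReal.ofReal (⟪(x : K), T ⟨x, h.choose_spec.1 x.2⟩⟫_ℂ).re
  else ⊤

/-- The composition `R X R` of a bounded operator `R` with a partially defined operator `X`, on its
natural domain `{x | R x ∈ D(X)}`. -/
noncomputable def sandwich (R : K →L[ℂ] K) (X : K →ₗ.[ℂ] K) : K →ₗ.[ℂ] K where
  domain := X.domain.comap (R : K →ₗ[ℂ] K)
  toFun := (R : K →ₗ[ℂ] K) ∘ₗ X.toFun ∘ₗ
    (((R : K →ₗ[ℂ] K).domRestrict (X.domain.comap (R : K →ₗ[ℂ] K))).codRestrict X.domain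
      (fun x => x.2))

/-- The linear span of all eigenvectors of `ρ` (those for the eigenvalue zero included). -/
def eigenspan (ρ : K →L[ℂ] K) : Submodule ℂ K :=
  ⨆ l : ℂ, Module.End.eigenspace (ρ : K →ₗ[ℂ] K) l

/-- `x` is a limit of vectors `y n` of the domain of `T` that form a Cauchy sequence for the
quadratic form `y ↦ ⟨y, T y⟩`. -/
def IsFormLimit (T : K →ₗ.[ℂ] K) (x : K) : Prop :=
  ∃ y : ℕ → T.domain, Filter.Tendsto (fun n => (y n : K)) Filter.atTop (nhds x) ∧
    ∀ ε : ℝ, 0 < ε → ∃ N : ℕ, ∀ m n : ℕ, N ≤ m → N ≤ n →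
      (⟪((y m - y n : T.domain) : K), T (y m - y n)⟫_ℂ).re < ε

/-- The domain of the closure of the quadratic form of `T`. For a positive operator `T` the form
limits already are a subspace, see `mem_formDomain_iff`; the span only makes the definition
total. -/
def formDomain (T : K →ₗ.[ℂ] K) : Submodule ℂ K :=
  Submodule.span ℂ {x | IsFormLimit T x}

theorem mem_formDomain_iff {T : K →ₗ.[ℂ] K}
    (hT : ∀ x : T.domain, 0 ≤ (⟪(x : K), T x⟫_ℂ).re) (x : K) :
    x ∈ formDomain T ↔ IsFormLimit T x := by
  refine ⟨fun hx => ?_, fun hx => Submodule.subset_span hx⟩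
  induction hx using Submodule.span_induction with
  | mem x hx => exact hx
  | zero =>
    refine ⟨fun _ => 0, by simp, fun ε hε => ⟨0, fun m n _ _ => by simpa using hε⟩⟩
  | add a b _ _ ha hb =>
    obtain ⟨y, hy, hyc⟩ := ha
    obtain ⟨z, hz, hzc⟩ := hb
    refine ⟨fun n => y n + z n, by simpa using hy.add hz, fun ε hε => ?_⟩
    obtain ⟨N, hN⟩ := hyc (ε / 4) (by linarith)
    obtain ⟨M, hM⟩ := hzc (ε / 4) (by linarith)
    refine ⟨max N M, fun m n hm hn => ?_⟩
    have h1 := hN m n (le_trans (le_max_left _ _) hm) (le_trans (le_max_left _ _) hn)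
    have h2 := hM m n (le_trans (le_max_right _ _) hm) (le_trans (le_max_right _ _) hn)
    have h3 := hT ((y m - y n) - (z m - z n))
    have key : ∀ p q : T.domain,
        (⟪((p + q : T.domain) : K), T (p + q)⟫_ℂ).re
          + (⟪((p - q : T.domain) : K), T (p - q)⟫_ℂ).re
          = 2 * (⟪(p : K), T p⟫_ℂ).re + 2 * (⟪(q : K), T q⟫_ℂ).re := by
      intro p q
      simp only [LinearPMap.map_add, LinearPMap.map_sub, Submodule.coe_add, Submodule.coe_sub,
        inner_add_left, inner_add_right, inner_sub_left, inner_sub_right, Complex.add_re,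
        Complex.sub_re]
      ring
    have h4 := key (y m - y n) (z m - z n)
    have h5 : (y m + z m) - (y n + z n) = (y m - y n) + (z m - z n) := by abel
    rw [h5]
    linarith
  | smul c a _ ha =>
    obtain ⟨y, hy, hyc⟩ := ha
    refine ⟨fun n => c • y n, by simpa using hy.const_smul c, fun ε hε => ?_⟩
    obtain ⟨N, hN⟩ := hyc (ε / (‖c‖ ^ 2 + 1)) (by positivity)
    refine ⟨N, fun m n hm hn => ?_⟩
    have h1 := hN m n hm hn
    have h0 := hT (y m - y n)
    have h5 : c • y m - c • y n = c • (y m - y n) := by rw [smul_sub]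
    have h6 : (⟪((c • (y m - y n) : T.domain) : K), T (c • (y m - y n))⟫_ℂ).re
        = ‖c‖ ^ 2 * (⟪((y m - y n : T.domain) : K), T (y m - y n)⟫_ℂ).re := by
      rw [LinearPMap.map_smul, Submodule.coe_smul, inner_smul_left, inner_smul_right,
        ← mul_assoc, Complex.conj_mul', ← Complex.ofReal_pow, Complex.re_ofReal_mul]
    rw [h5, h6]
    rw [lt_div_iff₀ (by positivity)] at h1
    nlinarith

end

section

variable {K : Type*} [NormedAddCommGroup K] [InnerProductSpace ℂ K] [CompleteSpace K]

/-- A state (density operator): a positive operator of trace one. -/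
def IsState (ρ : K →L[ℂ] K) : Prop :=
  ρ.IsPositive ∧ trace ((ρ : K →ₗ[ℂ] K).toPMap ⊤) = 1

/-- `ρ = ∑ r i |u i⟩⟨u i|` with `r i ≥ 0`, `∑ r i = 1` and `u` an orthonormal basis. -/
structure IsSpectralDecomposition {ι : Type*} (ρ : K →L[ℂ] K) (r : ι → ℝ)
    (u : HilbertBasis ι ℂ K) : Prop where
  nonneg : ∀ i, 0 ≤ r i
  hasSum_one : HasSum r 1
  hasSum_apply : ∀ x : K, HasSum (fun i => ((r i : ℂ) * ⟪u i, x⟫_ℂ) • u i) (ρ x)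

/-- A positive (possibly unbounded) selfadjoint operator. Selfadjointness includes density of the
domain, see `IsSelfAdjoint.dense_domain`. -/
def IsPositiveSelfAdjoint (T : K →ₗ.[ℂ] K) : Prop :=
  IsSelfAdjoint T ∧ ∀ x : T.domain, 0 ≤ (⟪(x : K), T x⟫_ℂ).re

open Classical in
/-- The power `σ ^ p`, `p ≠ 0`, of a positive bounded operator `σ`. For `p > 0` it is everywhere
defined; for `p < 0` it is the pseudoinverse of `σ ^ (-p)`, i.e. the inverse of the restriction of
`σ ^ (-p)` to `supp σ = (ker σ)ᗮ`, with domain the range of that restriction. -/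
noncomputable def power (σ : K →L[ℂ] K) (p : ℝ) : K →ₗ.[ℂ] K :=
  if 0 ≤ p then ((σ ^ p : K →L[ℂ] K) : K →ₗ[ℂ] K).toPMap ⊤
  else LinearPMap.inverse
    (((σ ^ (-p) : K →L[ℂ] K) : K →ₗ[ℂ] K).toPMap (LinearMap.ker (σ : K →ₗ[ℂ] K))ᗮ)

/-- The Friedrichs extension of a densely defined positive operator: the restriction of the adjoint
to the vectors that lie in the domain of the closure of the quadratic form. -/
noncomputable def friedrichs (T : K →ₗ.[ℂ] K) : K →ₗ.[ℂ] K :=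
  T.adjoint.domRestrict (formDomain T)

/-- The operator `ρ ^ (α / 2) σ ^ (1 - α) ρ ^ (α / 2)`: initially defined on the span of the
eigenvectors of `ρ`, then replaced by the Friedrichs extension. -/
noncomputable def petzOperator (ρ σ : K →L[ℂ] K) (α : ℝ) : K →ₗ.[ℂ] K :=
  friedrichs ((sandwich (ρ ^ (α / 2)) (power σ (1 - α))).domRestrict (eigenspan ρ))

/-- `ρ ^ (α / 2) σ ^ (1 - α) ρ ^ (α / 2)` is well defined as a positive selfadjoint operator: the
product makes sense on every eigenvector of `ρ`, and the resulting operator is positive and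
selfadjoint (hence densely defined). -/
def PetzOperatorDefined (ρ σ : K →L[ℂ] K) (α : ℝ) : Prop :=
  eigenspan ρ ≤ (sandwich (ρ ^ (α / 2)) (power σ (1 - α))).domain ∧
    IsPositiveSelfAdjoint (petzOperator ρ σ α)

open Classical in
/-- The Petz-Rényi `α`-relative entropy `D_α(ρ‖σ)`, with values in `[-∞, ∞]`, where
`log 0 = -∞` and `log ∞ = ∞`. -/
noncomputable def relativeEntropy (α : ℝ) (ρ σ : K →L[ℂ] K) : EReal :=
  if PetzOperatorDefined ρ σ α then
    (((α - 1)⁻¹ : ℝ) : EReal) * ENNReal.log (trace (petzOperator ρ σ α))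
  else ⊤

end

/-- The extended real number `∑_{i,j} r_i ^ α s_j ^ (1 - α) |⟨u_i, v_j⟩|²`, where `0 ^ p = ∞` for
`p < 0` and `0 * ∞ = 0`. -/
noncomputable def entropySum {K : Type*} [NormedAddCommGroup K] [InnerProductSpace ℂ K]
    {ι : Type*} (α : ℝ) (r s : ι → ℝ) (u v : ι → K) : ℝ≥0∞ :=
  ∑' i, ∑' j, ENNReal.ofReal (r i) ^ α * ENNReal.ofReal (s j) ^ (1 - α) *
    ENNReal.ofReal (‖⟪u i, v j⟫_ℂ‖ ^ 2)

end PetzRenyi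

/-!
Put `p = 1 - α` and `R = ρ ^ (α / 2)`. When `σ ^ p` is defined on the eigenvectors of `ρ` with
nonzero eigenvalue, the operator `T = R σ ^ p R` on the span of the eigenvectors of `ρ` has the
quadratic form `⟨x, T x⟩ = ‖A x‖²` with `A = σ ^ (p / 2) R`. Everything is read off from the closure
`G` of the graph of `A` in `K ⊕ K`.

The domain of the closed form is the projection of `G` to the first component
(`mem_formDomain_iff_exists_graphClosure`), and for `(x, b), (y, c)` in `G` with `y` in the domain
of the Friedrichs extension `F` of `T` one has `⟨x, F y⟩ = ⟨b, c⟩`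
(`inner_friedrichs_eq_inner_graphClosure`). Hence `F` is symmetric and positive. Projecting `(f, 0)`
orthogonally to `G` solves `(1 + F) x = f`, so that `F` is selfadjoint
(`isPositiveSelfAdjoint_friedrichs`).

The eigenvectors `v_j` of `σ` lie in the domain of `A*`, with `A* v_j = s_j ^ (p / 2) R v_j`.
Therefore `⟨w, F w⟩ = ‖b‖² = ∑_j |⟨A* v_j, w⟩|²` for `(w, b)` in `G`, and summing over any
orthonormal basis of vectors `w` gives `Tr F = ∑_j ‖A* v_j‖²` (`trace_friedrichs_eq_tsum`), which is
the double sum `∑_{i,j} r_i ^ α s_j ^ p |⟨u_i, v_j⟩|²`.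

The vectors `v_j` diagonalise every bounded power of `σ` (`rpow_apply_of_eigenvector`), hence also
the pseudoinverses; this describes the domain of `σ ^ p` in coordinates
(`IsSpectralDecomposition.mem_power_domain_iff`). Asking for `T` to be defined on all eigenvectors
of `ρ` is no more than asking for it on the `u_i`, since a nonzero eigenvalue of `ρ` has finite
multiplicity (`IsSpectralDecomposition.eigenspan_le_sandwich_domain_iff`).
-/

namespace PetzRenyi

/-! ### The Friedrichs extension of an operator with a factorised quadratic form -/

section FactorisedForm

variable {K H : Type*} [NormedAddCommGroup K] [InnerProductSpace ℂ K]
  [NormedAddCommGroup H] [InnerProductSpace ℂ H]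

/-- The closure of the graph of `A : D(T) → H`, as a subspace of the Hilbert sum `K ⊕ H`. It need
not be the graph of a function. -/
noncomputable def graphClosure (T : K →ₗ.[ℂ] K) (A : T.domain →ₗ[ℂ] H) :
    Submodule ℂ (WithLp 2 (K × H)) :=
  (LinearMap.range ((WithLp.linearEquiv 2 ℂ (K × H)).symm.toLinearMap ∘ₗ
    T.domain.subtype.prod A)).topologicalClosure

variable {T : K →ₗ.[ℂ] K} {A : T.domain →ₗ[ℂ] H}

theorem toLp_mem_graphClosure (x : T.domain) :
    WithLp.toLp 2 ((x : K), A x) ∈ graphClosure T A :=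
  Submodule.le_topologicalClosure _ ⟨x, rfl⟩

/-- A closed condition that holds on the graph of `A` holds on its closure. -/
theorem graphClosure_induction {P : K → H → Prop} (hP : IsClosed {z : K × H | P z.1 z.2})
    (h : ∀ x : T.domain, P x (A x)) {x : K} {b : H}
    (hx : WithLp.toLp 2 (x, b) ∈ graphClosure T A) : P x b := by
  have hcl : IsClosed {z : WithLp 2 (K × H) | P z.ofLp.1 z.ofLp.2} :=
    hP.preimage (WithLp.prod_continuous_ofLp 2 K H)
  refine closure_minimal (t := {z : WithLp 2 (K × H) | P z.ofLp.1 z.ofLp.2}) ?_ hcl hx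
  rintro _ ⟨y, rfl⟩
  exact h y

theorem mem_graphClosure_iff_exists_seq {x : K} {b : H} :
    WithLp.toLp 2 (x, b) ∈ graphClosure T A ↔
      ∃ y : ℕ → T.domain, Filter.Tendsto (fun n => (y n : K)) Filter.atTop (nhds x) ∧
        Filter.Tendsto (fun n => A (y n)) Filter.atTop (nhds b) := by
  constructor
  · intro h
    obtain ⟨z, hz, hzt⟩ := mem_closure_iff_seq_limit.1 h
    choose y hy using hz
    have h2 := ((WithLp.prod_continuous_ofLp 2 K H).tendsto _).comp hzt
    have h3 : (WithLp.ofLp ∘ z) = fun n => ((y n : K), A (y n)) := by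
      funext n; simp [← hy n]
    rw [h3] at h2
    exact ⟨y, (continuous_fst.tendsto _).comp h2, (continuous_snd.tendsto _).comp h2⟩
  · rintro ⟨y, h1, h2⟩
    exact mem_closure_iff_seq_limit.2 ⟨fun n => WithLp.toLp 2 ((y n : K), A (y n)),
      fun n => ⟨y n, rfl⟩,
      ((WithLp.prod_continuous_toLp 2 K H).tendsto _).comp (h1.prodMk_nhds h2)⟩

section

variable (hA : ∀ x y : T.domain, ⟪(x : K), T y⟫_ℂ = ⟪A x, A y⟫_ℂ)
include hA

theorem re_inner_self_eq_norm_sq (x : T.domain) : (⟪(x : K), T x⟫_ℂ).re = ‖A x‖ ^ 2 := by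
  rw [hA, ← inner_self_eq_norm_sq (𝕜 := ℂ)]; rfl

/-- The domain of the closed form is the projection of the closed graph of `A`. -/
theorem mem_formDomain_iff_exists_graphClosure [CompleteSpace H] (x : K) :
    x ∈ formDomain T ↔ ∃ b : H, WithLp.toLp 2 (x, b) ∈ graphClosure T A := by
  rw [mem_formDomain_iff (fun x => by rw [re_inner_self_eq_norm_sq hA]; positivity)]
  constructor
  · rintro ⟨y, hy, hc⟩
    have hcauchy : CauchySeq fun n => A (y n) := by
      rw [Metric.cauchySeq_iff]
      intro ε hε
      obtain ⟨N, hN⟩ := hc (ε ^ 2) (by positivity)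
      refine ⟨N, fun m hm n hn => ?_⟩
      have h := hN m n hm hn
      rw [re_inner_self_eq_norm_sq hA, map_sub] at h
      rw [dist_eq_norm]
      exact lt_of_pow_lt_pow_left₀ 2 hε.le h
    obtain ⟨b, hb⟩ := cauchySeq_tendsto_of_complete hcauchy
    exact ⟨b, mem_graphClosure_iff_exists_seq.2 ⟨y, hy, hb⟩⟩
  · rintro ⟨b, hb⟩
    obtain ⟨y, hy, hyb⟩ := mem_graphClosure_iff_exists_seq.1 hb
    refine ⟨y, hy, fun ε hε => ?_⟩
    obtain ⟨N, hN⟩ := Metric.cauchySeq_iff.1 hyb.cauchySeq (√ε) (Real.sqrt_pos.2 hε)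
    refine ⟨N, fun m n hm hn => ?_⟩
    have h := hN m hm n hn
    rw [dist_eq_norm] at h
    rw [re_inner_self_eq_norm_sq hA, map_sub]
    calc _ < √ε ^ 2 := by gcongr
      _ = ε := Real.sq_sqrt hε.le

variable [CompleteSpace K]

section

variable [CompleteSpace H]

theorem exists_graphClosure_of_mem_friedrichs (y : (friedrichs T).domain) :
    ∃ c : H, WithLp.toLp 2 ((y : K), c) ∈ graphClosure T A :=
  (mem_formDomain_iff_exists_graphClosure hA _).1 y.2.1

theorem domain_le_domain_friedrichs : T.domain ≤ (friedrichs T).domain := by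
  intro x hx
  refine ⟨(mem_formDomain_iff_exists_graphClosure hA _).2 ⟨_, toLp_mem_graphClosure ⟨x, hx⟩⟩,
    LinearPMap.mem_adjoint_domain_of_exists _ ⟨T ⟨x, hx⟩, fun z => ?_⟩⟩
  rw [← inner_conj_symm, hA, inner_conj_symm]
  exact (hA ⟨x, hx⟩ z).symm

end

variable (hT : Dense (T.domain : Set K))
include hT

/-- The adjoint of `T` represents the closed form: if `(x, b)` and `(y, c)` lie in the closed graph
of `A` and `y` in the domain of `T†`, then `⟨x, T† y⟩ = ⟨b, c⟩`. -/
theorem inner_adjoint_eq_inner_graphClosure {x y : K} {b c : H}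
    (hx : WithLp.toLp 2 (x, b) ∈ graphClosure T A) (hy : WithLp.toLp 2 (y, c) ∈ graphClosure T A)
    (hyT : y ∈ T.adjoint.domain) : ⟪x, T.adjoint ⟨y, hyT⟩⟫_ℂ = ⟪b, c⟫_ℂ := by
  have h1 : ∀ z : T.domain, ⟪T z, y⟫_ℂ = ⟪A z, c⟫_ℂ := fun z =>
    graphClosure_induction (T := T) (A := A) (P := fun y c => ⟪T z, y⟫_ℂ = ⟪A z, c⟫_ℂ)
      (isClosed_eq (by fun_prop) (by fun_prop))
      (fun w => by rw [← hA, ← inner_conj_symm, hA, inner_conj_symm, hA]) hy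
  refine graphClosure_induction (T := T) (A := A)
    (P := fun x b => ⟪x, T.adjoint ⟨y, hyT⟩⟫_ℂ = ⟪b, c⟫_ℂ)
      (isClosed_eq (by fun_prop) (by fun_prop)) (fun z => ?_) hx
  rw [← h1 z]
  exact ((LinearPMap.adjoint_isFormalAdjoint hT).symm z ⟨y, hyT⟩).symm

theorem inner_friedrichs_eq_inner_graphClosure {x : K} {y : (friedrichs T).domain} {b c : H}
    (hx : WithLp.toLp 2 (x, b) ∈ graphClosure T A)
    (hy : WithLp.toLp 2 ((y : K), c) ∈ graphClosure T A) :
    ⟪x, friedrichs T y⟫_ℂ = ⟪b, c⟫_ℂ :=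
  inner_adjoint_eq_inner_graphClosure hA hT hx hy y.2.2

variable [CompleteSpace H]

/-- The Friedrichs extension is symmetric. -/
theorem inner_friedrichs_comm (x y : (friedrichs T).domain) :
    ⟪friedrichs T x, (y : K)⟫_ℂ = ⟪(x : K), friedrichs T y⟫_ℂ := by
  obtain ⟨b, hb⟩ := exists_graphClosure_of_mem_friedrichs hA x
  obtain ⟨c, hc⟩ := exists_graphClosure_of_mem_friedrichs hA y
  rw [inner_friedrichs_eq_inner_graphClosure hA hT hb hc, ← inner_conj_symm,
    inner_friedrichs_eq_inner_graphClosure hA hT hc hb, inner_conj_symm]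

/-- `1 + T` is onto for the Friedrichs extension: the preimage of `f` is the first component of the
orthogonal projection of `(f, 0)` to the closed graph of `A`. -/
theorem exists_add_friedrichs_eq (f : K) :
    ∃ x : (friedrichs T).domain, (x : K) + friedrichs T x = f := by
  have hcl : IsClosed (graphClosure T A : Set (WithLp 2 (K × H))) :=
    Submodule.isClosed_topologicalClosure _
  have : CompleteSpace (graphClosure T A) := hcl.completeSpace_coe
  obtain ⟨z, hz, w, hw, hzw⟩ :=
    (graphClosure T A).exists_add_mem_mem_orthogonal (WithLp.toLp 2 (f, (0 : H)))
  have hz' : WithLp.toLp 2 (z.fst, z.snd) ∈ graphClosure T A := hz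
  have hw1 : w.fst = f - z.fst := by
    have := congrArg WithLp.fst hzw
    simp only [WithLp.add_fst] at this
    rw [eq_sub_iff_add_eq, add_comm]; exact this.symm
  have hw2 : w.snd = - z.snd := by
    have := congrArg WithLp.snd hzw
    simp only [WithLp.add_snd] at this
    rw [eq_neg_iff_add_eq_zero, add_comm]; exact this.symm
  have key : ∀ y : T.domain, ⟪f - z.fst, (y : K)⟫_ℂ = ⟪z.fst, T y⟫_ℂ := by
    intro y
    have h1 : ⟪z.fst, T y⟫_ℂ = ⟪z.snd, A y⟫_ℂ :=
      graphClosure_induction (T := T) (A := A) (P := fun x b => ⟪x, T y⟫_ℂ = ⟪b, A y⟫_ℂ)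
        (isClosed_eq (by fun_prop) (by fun_prop)) (fun x => hA x y) hz'
    have h2 := (Submodule.mem_orthogonal' _ _).1 hw _ (toLp_mem_graphClosure (A := A) y)
    rw [WithLp.prod_inner_apply] at h2
    change ⟪w.fst, (y : K)⟫_ℂ + ⟪w.snd, A y⟫_ℂ = 0 at h2
    rw [hw1, hw2, inner_neg_left] at h2
    rw [h1]
    linear_combination h2
  have hmem : z.fst ∈ T.adjoint.domain := LinearPMap.mem_adjoint_domain_of_exists _ ⟨_, key⟩
  refine ⟨⟨z.fst, (mem_formDomain_iff_exists_graphClosure hA _).2 ⟨_, hz'⟩, hmem⟩, ?_⟩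
  have : friedrichs T ⟨z.fst, (mem_formDomain_iff_exists_graphClosure hA _).2 ⟨_, hz'⟩, hmem⟩
      = f - z.fst :=
    LinearPMap.adjoint_apply_eq hT ⟨z.fst, hmem⟩ key
  rw [this]
  exact add_sub_cancel _ _

/-- The Friedrichs extension of a densely defined operator `T` whose quadratic form is `‖A x‖²` is
positive and selfadjoint: it is symmetric, and `1 + T` is onto. -/
theorem isPositiveSelfAdjoint_friedrichs : IsPositiveSelfAdjoint (friedrichs T) := by
  have hdense : Dense ((friedrichs T).domain : Set K) :=
    hT.mono (domain_le_domain_friedrichs hA)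
  have hsymm : (friedrichs T).IsFormalAdjoint (friedrichs T) := inner_friedrichs_comm hA hT
  refine ⟨?_, fun x => ?_⟩
  · rw [LinearPMap.isSelfAdjoint_def]
    refine (LinearPMap.eq_of_le_of_domain_eq (hsymm.le_adjoint hdense)
      (le_antisymm (hsymm.le_adjoint hdense).1 ?_)).symm
    intro z hz
    obtain ⟨x, hx⟩ := exists_add_friedrichs_eq hA hT (z + (friedrichs T).adjoint ⟨z, hz⟩)
    obtain ⟨y, hy⟩ := exists_add_friedrichs_eq hA hT (z - x)
    have h1 := LinearPMap.adjoint_isFormalAdjoint hdense ⟨z, hz⟩ y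
    have h2 := hsymm x y
    -- `z - x` is orthogonal to the range of `1 + T`, which contains `z - x`.
    have h3 : ⟪z - x, z - x⟫_ℂ = 0 := by
      have h4 : ⟪z + (friedrichs T).adjoint ⟨z, hz⟩, (y : K)⟫_ℂ
          = ⟪(x : K) + friedrichs T x, (y : K)⟫_ℂ := by rw [hx]
      rw [inner_add_left, inner_add_left, h1, h2] at h4
      have h5 : ⟪z - x, (y : K) + friedrichs T y⟫_ℂ = 0 := by
        rw [inner_add_right, inner_sub_left, inner_sub_left]
        linear_combination h4
      rwa [hy] at h5
    rw [inner_self_eq_zero, sub_eq_zero] at h3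
    rw [h3]
    exact x.2
  · obtain ⟨b, hb⟩ := exists_graphClosure_of_mem_friedrichs hA x
    rw [inner_friedrichs_eq_inner_graphClosure hA hT hb hb]
    exact inner_self_nonneg (𝕜 := ℂ)

end

end FactorisedForm

/-! ### Hilbert bases and the trace -/

section Basis

variable {K H : Type*} [NormedAddCommGroup K] [InnerProductSpace ℂ K]
  [NormedAddCommGroup H] [InnerProductSpace ℂ H] {κ : Type*}

theorem hilbertBasis_ext (b : HilbertBasis κ ℂ K) {x y : K}
    (h : ∀ j, ⟪b j, x⟫_ℂ = ⟪b j, y⟫_ℂ) : x = y := by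
  refine b.repr.injective (lp.ext (funext fun j => ?_))
  rw [b.repr_apply_apply, b.repr_apply_apply, h]

theorem tsum_ofReal_norm_inner_sq (b : HilbertBasis κ ℂ K) (x : K) :
    ∑' j, ENNReal.ofReal (‖⟪b j, x⟫_ℂ‖ ^ 2) = ENNReal.ofReal (‖x‖ ^ 2) := by
  have h : HasSum (fun j => ‖⟪b j, x⟫_ℂ‖ ^ 2) (‖x‖ ^ 2) := by
    have h1 := (b.hasSum_inner_mul_inner x x).mapL Complex.reCLM
    convert h1 using 1
    · funext j
      rw [← inner_conj_symm x, Complex.conj_mul']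
      simp [← Complex.ofReal_pow]
    · rw [← inner_self_eq_norm_sq (𝕜 := ℂ)]; rfl
  rw [← ENNReal.ofReal_tsum_of_nonneg (fun _ => by positivity) h.summable, h.tsum_eq]

theorem isOrthonormalBasisIn_range (b : HilbertBasis κ ℂ K) {D : Submodule ℂ K}
    (h : ∀ j, b j ∈ D) : IsOrthonormalBasisIn D (Set.range b) :=
  ⟨Set.range_subset_iff.2 h, b.orthonormal.toSubtypeRange, b.dense_span⟩

variable [CompleteSpace K] [CompleteSpace H]

/-- The trace of the Friedrichs extension of an operator with quadratic form `‖A x‖²` is the sum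
of the `‖A* v_j‖²` over any Hilbert basis `v` contained in the domain of `A*` (here `g j` is
`A* v_j`). It is the interchange of the two summations in `∑_k ∑_j |⟨v_j, A w_k⟩|²`. -/
theorem trace_friedrichs_eq_tsum {T : K →ₗ.[ℂ] K} {A : T.domain →ₗ[ℂ] H}
    (hA : ∀ x y : T.domain, ⟪(x : K), T y⟫_ℂ = ⟪A x, A y⟫_ℂ)
    (hT : Dense (T.domain : Set K))
    (hS : ∃ S : Set K, IsOrthonormalBasisIn (friedrichs T).domain S)
    (v : HilbertBasis κ ℂ H) (g : κ → K) (hg : ∀ j (x : T.domain), ⟪v j, A x⟫_ℂ = ⟪g j, (x : K)⟫_ℂ) :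
    trace (friedrichs T) = ∑' j, ENNReal.ofReal (‖g j‖ ^ 2) := by
  have key : ∀ w : (friedrichs T).domain,
      ENNReal.ofReal (⟪(w : K), friedrichs T w⟫_ℂ).re
        = ∑' j, ENNReal.ofReal (‖⟪(w : K), g j⟫_ℂ‖ ^ 2) := by
    intro w
    obtain ⟨b, hb⟩ := exists_graphClosure_of_mem_friedrichs hA w
    rw [inner_friedrichs_eq_inner_graphClosure hA hT hb hb]
    have h1 : (⟪b, b⟫_ℂ).re = ‖b‖ ^ 2 := inner_self_eq_norm_sq (𝕜 := ℂ) b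
    rw [h1, ← tsum_ofReal_norm_inner_sq v]
    refine tsum_congr fun j => ?_
    rw [norm_inner_symm (w : K)]
    have h2 : ⟪v j, b⟫_ℂ = ⟪g j, (w : K)⟫_ℂ :=
      graphClosure_induction (T := T) (A := A) (P := fun x b => ⟪v j, b⟫_ℂ = ⟪g j, x⟫_ℂ)
        (isClosed_eq (by fun_prop) (by fun_prop)) (hg j) hb
    rw [h2]
  rw [trace, dif_pos hS]
  obtain ⟨-, ho, hd⟩ := hS.choose_spec
  let w : HilbertBasis hS.choose ℂ K := HilbertBasis.mk ho (by simpa using hd.ge)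
  have hw : ∀ k, w k = (k : K) := fun k => congrFun (HilbertBasis.coe_mk ho _) k
  calc _ = ∑' k : hS.choose, ∑' j, ENNReal.ofReal (‖⟪w k, g j⟫_ℂ‖ ^ 2) :=
        tsum_congr fun k => by rw [hw]; exact key ⟨k, hS.choose_spec.1 k.2⟩
    _ = ∑' j, ∑' k : hS.choose, ENNReal.ofReal (‖⟪w k, g j⟫_ℂ‖ ^ 2) := ENNReal.tsum_comm
    _ = _ := tsum_congr fun j => tsum_ofReal_norm_inner_sq w (g j)

end Basis

/-! ### Powers of a diagonal operator -/

section Powers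

variable {K : Type*} [NormedAddCommGroup K] [InnerProductSpace ℂ K]
  {ι : Type*} {σ : K →L[ℂ] K} {s : ι → ℝ} {v : HilbertBasis ι ℂ K}

theorem IsSpectralDecomposition.apply_basis (hs : IsSpectralDecomposition σ s v) (j : ι) :
    σ (v j) = (s j : ℂ) • v j := by
  have h := hs.hasSum_apply (v j)
  have h2 := hasSum_single (f := fun i => ((s i : ℂ) * ⟪v i, v j⟫_ℂ) • v i) j
    (fun i hi => by simp [v.orthonormal.2 hi])
  rw [h.unique h2, inner_self_eq_norm_sq_to_K, v.orthonormal.1 j]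
  simp

theorem IsSpectralDecomposition.le_one (hs : IsSpectralDecomposition σ s v) (j : ι) : s j ≤ 1 :=
  le_hasSum hs.hasSum_one j fun i _ => hs.nonneg i

theorem IsSpectralDecomposition.inner_apply (hs : IsSpectralDecomposition σ s v)
    (hσ : σ.IsPositive) (j : ι) (x : K) : ⟪v j, σ x⟫_ℂ = s j * ⟪v j, x⟫_ℂ := by
  have h : ⟪σ (v j), x⟫_ℂ = ⟪v j, σ x⟫_ℂ := hσ.isSymmetric (v j) x
  rw [← h, hs.apply_basis, inner_smul_left, Complex.conj_ofReal]

theorem IsSpectralDecomposition.mem_ker_orthogonal_iff (hs : IsSpectralDecomposition σ s v)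
    (hσ : σ.IsPositive) (y : K) :
    y ∈ (LinearMap.ker (σ : K →ₗ[ℂ] K))ᗮ ↔ ∀ j, s j = 0 → ⟪v j, y⟫_ℂ = 0 := by
  constructor
  · intro h j hj
    refine (Submodule.mem_orthogonal _ _).1 h (v j) ?_
    rw [LinearMap.mem_ker]
    change σ (v j) = 0
    rw [hs.apply_basis, hj]; simp
  · intro h
    refine (Submodule.mem_orthogonal _ _).2 fun x hx => ?_
    have hx' : σ x = 0 := hx
    rw [← v.tsum_inner_mul_inner x y]
    refine (tsum_congr fun j => ?_).trans tsum_zero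
    rcases eq_or_ne (s j) 0 with hj | hj
    · rw [h j hj, mul_zero]
    · have h1 := hs.inner_apply hσ j x
      rw [hx', inner_zero_right, eq_comm, mul_eq_zero] at h1
      have h2 : ⟪v j, x⟫_ℂ = 0 := h1.resolve_left (by exact_mod_cast hj)
      rw [← inner_conj_symm, h2]; simp

variable [CompleteSpace K]

/-- The continuous functional calculus acts on an eigenvector through the value of the function at
the eigenvalue. -/
theorem cfc_apply_eq_of_eigenvector {a : K →L[ℂ] K} (ha : IsSelfAdjoint a) {f : ℝ → ℝ}
    (hf : ContinuousOn f (spectrum ℝ a)) {t : ℝ} {x : K} (hx : a x = (t : ℂ) • x) :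
    cfc f a x = (f t : ℂ) • x := by
  rcases eq_or_ne x 0 with rfl | hx0
  · simp
  have ht : t ∈ spectrum ℝ a := by
    rw [spectrum.mem_iff]
    intro hu
    obtain ⟨b, hb⟩ := hu.exists_left_inv
    have h1 := congrArg (fun c : K →L[ℂ] K => c x) hb
    have h2 : (algebraMap ℝ (K →L[ℂ] K) t - a) x = 0 := by
      simp [Algebra.algebraMap_eq_smul_one, hx]
    simp only [mul_apply_eq_comp, h2, map_zero, one_apply_eq_self] at h1
    exact hx0 h1.symm
  have key : ∀ g : C(spectrum ℝ a, ℝ), cfcHom ha g x = (g ⟨t, ht⟩ : ℂ) • x := by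
    intro g
    induction g using ContinuousMap.induction_on_of_compact with
    | const c =>
      have : (ContinuousMap.const (spectrum ℝ a) c) = algebraMap ℝ C(spectrum ℝ a, ℝ) c := rfl
      rw [this, AlgHomClass.commutes]
      simp [Algebra.algebraMap_eq_smul_one]
    | id => rw [cfcHom_id ha, hx]; rfl
    | star_id => rw [star_trivial, cfcHom_id ha, hx]; rfl
    | add f g hf hg => simp [hf, hg, add_smul]
    | mul f g hf hg =>
      rw [map_mul, mul_apply_eq_comp, hg, map_smul, hf, smul_smul, mul_comm,
        ContinuousMap.mul_apply, Complex.ofReal_mul]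
    | frequently f h =>
      have hcl : IsClosed {g : C(spectrum ℝ a, ℝ) | cfcHom ha g x = (g ⟨t, ht⟩ : ℂ) • x} := by
        refine isClosed_eq ?_ ?_
        · exact (ContinuousLinearMap.apply ℂ K x).continuous.comp (cfcHom_continuous ha)
        · exact (Complex.continuous_ofReal.comp (continuous_eval_const (⟨t, ht⟩ : spectrum ℝ a))).smul
            continuous_const
      exact hcl.mem_of_frequently_of_tendsto h Filter.tendsto_id
  rw [cfc_apply f a ha hf, key]
  rfl

theorem rpow_apply_of_eigenvector {a : K →L[ℂ] K} (ha : a.IsPositive) {p : ℝ} (hp : 0 ≤ p) {t : ℝ}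
    {x : K} (hx : a x = (t : ℂ) • x) : (a ^ p) x = ((t ^ p : ℝ) : ℂ) • x := by
  have ha' : 0 ≤ a := (ContinuousLinearMap.nonneg_iff_isPositive a).2 ha
  rw [CFC.rpow_eq_cfc_real ha']
  exact cfc_apply_eq_of_eigenvector ha.isSelfAdjoint
    (Real.continuous_rpow_const hp).continuousOn hx

theorem inner_rpow_apply_comm (a : K →L[ℂ] K) (p : ℝ) (x y : K) :
    ⟪x, (a ^ p) y⟫_ℂ = ⟪(a ^ p) x, y⟫_ℂ :=
  (((ContinuousLinearMap.nonneg_iff_isPositive _).1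
    (CFC.rpow_nonneg (a := a) (y := p))).isSymmetric x y).symm

theorem IsSpectralDecomposition.inner_rpow_apply (hs : IsSpectralDecomposition σ s v)
    (hσ : σ.IsPositive) {p : ℝ} (hp : 0 ≤ p) (j : ι) (x : K) :
    ⟪v j, (σ ^ p) x⟫_ℂ = ((s j ^ p : ℝ) : ℂ) * ⟪v j, x⟫_ℂ := by
  rw [inner_rpow_apply_comm, rpow_apply_of_eigenvector hσ hp (hs.apply_basis j), inner_smul_left,
    Complex.conj_ofReal]

theorem mem_power_domain_iff_of_neg {p : ℝ} (hp : p < 0) (y : K) :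
    y ∈ (power σ p).domain ↔ ∃ w ∈ (LinearMap.ker (σ : K →ₗ[ℂ] K))ᗮ, (σ ^ (-p)) w = y := by
  rw [power, if_neg hp.not_ge, LinearPMap.inverse_domain]
  exact ⟨fun ⟨w, hw⟩ => ⟨w, w.2, hw⟩, fun ⟨w, hw, h⟩ => ⟨⟨w, hw⟩, h⟩⟩

theorem IsSpectralDecomposition.eq_zero_of_rpow_apply_eq_zero
    (hs : IsSpectralDecomposition σ s v) (hσ : σ.IsPositive) {q : ℝ} (hq : 0 < q) {w : K}
    (hw : w ∈ (LinearMap.ker (σ : K →ₗ[ℂ] K))ᗮ) (h : (σ ^ q) w = 0) : w = 0 := by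
  refine hilbertBasis_ext v fun j => ?_
  rw [inner_zero_right]
  rcases eq_or_ne (s j) 0 with hj | hj
  · exact (hs.mem_ker_orthogonal_iff hσ w).1 hw j hj
  · have h1 := hs.inner_rpow_apply hσ hq.le j w
    rw [h, inner_zero_right, eq_comm, mul_eq_zero] at h1
    refine h1.resolve_left ?_
    exact_mod_cast (Real.rpow_pos_of_pos (lt_of_le_of_ne (hs.nonneg j) hj.symm) q).ne'

theorem IsSpectralDecomposition.power_apply_of_neg (hs : IsSpectralDecomposition σ s v)
    (hσ : σ.IsPositive) {p : ℝ} (hp : p < 0) {w : K}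
    (hw : w ∈ (LinearMap.ker (σ : K →ₗ[ℂ] K))ᗮ) (y : (power σ p).domain)
    (hy : (σ ^ (-p)) w = y) : power σ p y = w := by
  have hpow : power σ p = LinearPMap.inverse
      (((σ ^ (-p) : K →L[ℂ] K) : K →ₗ[ℂ] K).toPMap (LinearMap.ker (σ : K →ₗ[ℂ] K))ᗮ) := by
    rw [power, if_neg hp.not_ge]
  revert y
  rw [hpow]
  intro y hy
  refine LinearPMap.inverse_apply_eq (x := ⟨w, hw⟩) ?_ hy
  rw [LinearMap.ker_eq_bot']
  intro z hz
  exact Subtype.ext (hs.eq_zero_of_rpow_apply_eq_zero hσ (neg_pos.2 hp) z.2 hz)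

/-- For `p < 0` the domain of `σ ^ p` is contained in the support of `σ`. -/
theorem IsSpectralDecomposition.inner_eq_zero_of_mem_power_domain
    (hs : IsSpectralDecomposition σ s v) (hσ : σ.IsPositive) {p : ℝ} (hp : p < 0) {y : K}
    (hy : y ∈ (power σ p).domain) {j : ι} (hj : s j = 0) : ⟪v j, y⟫_ℂ = 0 := by
  obtain ⟨w, hw, rfl⟩ := (mem_power_domain_iff_of_neg hp y).1 hy
  rw [hs.inner_rpow_apply hσ (neg_pos.2 hp).le, (hs.mem_ker_orthogonal_iff hσ w).1 hw j hj,
    mul_zero]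

/-- The coordinates of `σ ^ p y`. The real power `0 ^ p` is `0`, so that the formula is also
correct off the support of `σ`. -/
theorem IsSpectralDecomposition.inner_power_apply (hs : IsSpectralDecomposition σ s v)
    (hσ : σ.IsPositive) {p : ℝ} (hp : p ≠ 0) (y : (power σ p).domain) (j : ι) :
    ⟪v j, power σ p y⟫_ℂ = ((s j ^ p : ℝ) : ℂ) * ⟪v j, (y : K)⟫_ℂ := by
  rcases hp.lt_or_gt with hp | hp
  · obtain ⟨w, hw, h⟩ := (mem_power_domain_iff_of_neg hp (y : K)).1 y.2
    rw [hs.power_apply_of_neg hσ hp hw y h, ← h, hs.inner_rpow_apply hσ (neg_pos.2 hp).le,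
      ← mul_assoc, ← Complex.ofReal_mul]
    rcases (hs.nonneg j).eq_or_lt with hj | hj
    · rw [(hs.mem_ker_orthogonal_iff hσ w).1 hw j hj.symm, mul_zero]
    · rw [← Real.rpow_add hj, add_neg_cancel, Real.rpow_zero, Complex.ofReal_one, one_mul]
  · have hpow : power σ p = ((σ ^ p : K →L[ℂ] K) : K →ₗ[ℂ] K).toPMap ⊤ := by
      rw [power, if_pos hp.le]
    revert y
    rw [hpow]
    intro y
    exact hs.inner_rpow_apply hσ hp.le j y

/-- The square root `σ ^ (p / 2)` on the domain of `σ ^ p`. -/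
theorem IsSpectralDecomposition.exists_sqrt_power (hs : IsSpectralDecomposition σ s v)
    (hσ : σ.IsPositive) {p : ℝ} (hp : p ≠ 0) :
    ∃ B : (power σ p).domain →ₗ[ℂ] K, ∀ y j,
      ⟪v j, B y⟫_ℂ = ((s j ^ (p / 2) : ℝ) : ℂ) * ⟪v j, (y : K)⟫_ℂ := by
  rcases hp.lt_or_gt with hp' | hp'
  · -- for negative `p` the square root is `σ ^ (-p / 2) σ ^ p`
    refine ⟨((σ ^ (-p / 2) : K →L[ℂ] K) : K →ₗ[ℂ] K) ∘ₗ (power σ p).toFun, fun y j => ?_⟩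
    change ⟪v j, (σ ^ (-p / 2)) (power σ p y)⟫_ℂ = _
    rw [hs.inner_rpow_apply hσ (by linarith), hs.inner_power_apply hσ hp, ← mul_assoc,
      ← Complex.ofReal_mul]
    rcases (hs.nonneg j).eq_or_lt with hj | hj
    · rw [hs.inner_eq_zero_of_mem_power_domain hσ hp' y.2 hj.symm, mul_zero, mul_zero]
    · rw [← Real.rpow_add hj]
      congr 4
      ring
  · exact ⟨((σ ^ (p / 2) : K →L[ℂ] K) : K →ₗ[ℂ] K) ∘ₗ (power σ p).domain.subtype,
      fun y j => hs.inner_rpow_apply hσ (by linarith) j (y : K)⟩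

theorem IsSpectralDecomposition.inner_power_eq_inner_sqrt (hs : IsSpectralDecomposition σ s v)
    (hσ : σ.IsPositive) {p : ℝ} (hp : p ≠ 0) {B : (power σ p).domain →ₗ[ℂ] K}
    (hB : ∀ y j, ⟪v j, B y⟫_ℂ = ((s j ^ (p / 2) : ℝ) : ℂ) * ⟪v j, (y : K)⟫_ℂ)
    (x y : (power σ p).domain) : ⟪(x : K), power σ p y⟫_ℂ = ⟪B x, B y⟫_ℂ := by
  rw [← v.tsum_inner_mul_inner (x : K), ← v.tsum_inner_mul_inner (B x)]
  refine tsum_congr fun j => ?_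
  rw [hs.inner_power_apply hσ hp, ← inner_conj_symm (B x), hB, hB, map_mul, Complex.conj_ofReal,
    inner_conj_symm]
  have : s j ^ p = s j ^ (p / 2) * s j ^ (p / 2) := by
    rw [← Real.rpow_add' (hs.nonneg j) (by simpa using hp), add_halves]
  rw [this]
  push_cast
  ring

/-- Membership in the domain of `σ ^ p` in terms of coordinates. In `[0, ∞]` the power `0 ^ (2 * p)`
is `∞` for `p < 0`, which forces the coordinates off the support of `σ` to vanish. -/
theorem IsSpectralDecomposition.mem_power_domain_iff (hs : IsSpectralDecomposition σ s v)
    (hσ : σ.IsPositive) {p : ℝ} (hp : p ≠ 0) (x : K) :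
    x ∈ (power σ p).domain ↔
      ∑' j, ENNReal.ofReal (s j) ^ (2 * p) * ENNReal.ofReal (‖⟪x, v j⟫_ℂ‖ ^ 2) < ⊤ := by
  rcases hp.lt_or_gt with hp' | hp'
  · have hterm : ∀ j, 0 < s j → ENNReal.ofReal (s j) ^ (2 * p) * ENNReal.ofReal (‖⟪x, v j⟫_ℂ‖ ^ 2)
        = ENNReal.ofReal (‖((s j ^ p : ℝ) : ℂ) * ⟪v j, x⟫_ℂ‖ ^ 2) := by
      intro j hj
      rw [ENNReal.ofReal_rpow_of_pos hj, ← ENNReal.ofReal_mul (by positivity), norm_mul, mul_pow,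
        norm_inner_symm, Complex.norm_real, Real.norm_of_nonneg (by positivity),
        ← Real.rpow_mul_natCast hj.le]
      congr 3
      push_cast
      ring
    constructor
    · intro hx
      obtain ⟨w, hw, h⟩ := (mem_power_domain_iff_of_neg hp' x).1 hx
      refine lt_of_le_of_lt ?_ (ENNReal.ofReal_lt_top (r := ‖w‖ ^ 2))
      rw [← tsum_ofReal_norm_inner_sq v w]
      refine ENNReal.tsum_le_tsum fun j => ?_
      rcases (hs.nonneg j).eq_or_lt with hj | hj
      · have : ⟪x, v j⟫_ℂ = 0 := by
          rw [← inner_conj_symm, hs.inner_eq_zero_of_mem_power_domain hσ hp' hx hj.symm, map_zero]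
        simp [this]
      · rw [hterm j hj, ← h, hs.inner_rpow_apply hσ (neg_pos.2 hp').le, ← mul_assoc,
          ← Complex.ofReal_mul, ← Real.rpow_add hj, add_neg_cancel, Real.rpow_zero,
          Complex.ofReal_one, one_mul]
    · intro hsum
      have hzero : ∀ j, s j = 0 → ⟪v j, x⟫_ℂ = 0 := by
        intro j hj
        by_contra hne
        refine ENNReal.ne_top_of_tsum_ne_top hsum.ne j ?_
        rw [hj, ENNReal.ofReal_zero, ENNReal.zero_rpow_of_neg (by linarith), ENNReal.top_mul]
        rw [norm_inner_symm]
        have : 0 < ‖⟪v j, x⟫_ℂ‖ := norm_pos_iff.2 hne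
        exact (ENNReal.ofReal_pos.2 (by positivity)).ne'
      have hmem : Memℓp (fun j => ((s j ^ p : ℝ) : ℂ) * ⟪v j, x⟫_ℂ) 2 := by
        refine memℓp_gen ?_
        have h1 : ∑' j, ENNReal.ofReal (‖((s j ^ p : ℝ) : ℂ) * ⟪v j, x⟫_ℂ‖ ^ 2) ≠ ⊤ := by
          convert! hsum.ne using 1
          refine tsum_congr fun j => ?_
          rcases (hs.nonneg j).eq_or_lt with hj | hj
          · rw [norm_inner_symm x, hzero j hj.symm]; simp
          · exact (hterm j hj).symm
        have h2 := ENNReal.summable_toReal h1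
        refine h2.congr fun j => ?_
        rw [ENNReal.toReal_ofReal (by positivity)]
        simp
      have hw : ∀ j, ⟪v j, v.repr.symm ⟨_, hmem⟩⟫_ℂ = ((s j ^ p : ℝ) : ℂ) * ⟪v j, x⟫_ℂ := by
        intro j
        rw [← v.repr_apply_apply, LinearIsometryEquiv.apply_symm_apply]
      refine (mem_power_domain_iff_of_neg hp' x).2 ⟨v.repr.symm ⟨_, hmem⟩, ?_, ?_⟩
      · refine (hs.mem_ker_orthogonal_iff hσ _).2 fun j hj => ?_
        rw [hw, hzero j hj, mul_zero]
      · refine hilbertBasis_ext v fun j => ?_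
        rw [hs.inner_rpow_apply hσ (neg_pos.2 hp').le, hw]
        rcases (hs.nonneg j).eq_or_lt with hj | hj
        · rw [hzero j hj.symm, mul_zero, mul_zero]
        · rw [← mul_assoc, ← Complex.ofReal_mul, ← Real.rpow_add hj, neg_add_cancel,
            Real.rpow_zero, Complex.ofReal_one, one_mul]
  · have hx : x ∈ (power σ p).domain := by
      rw [power, if_pos hp'.le]; exact Submodule.mem_top
    refine iff_of_true hx (lt_of_le_of_lt ?_ (ENNReal.ofReal_lt_top (r := ‖x‖ ^ 2)))
    rw [← tsum_ofReal_norm_inner_sq v x]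
    refine ENNReal.tsum_le_tsum fun j => ?_
    rw [norm_inner_symm]
    refine mul_le_of_le_one_left' (ENNReal.rpow_le_one ?_ (by linarith))
    exact ENNReal.ofReal_le_one.2 (hs.le_one j)

end Powers

/-! ### The operator of the relative entropy -/

section Petz

variable {K : Type*} [NormedAddCommGroup K] [InnerProductSpace ℂ K] {ι : Type*}
  {ρ σ : K →L[ℂ] K} {r s : ι → ℝ} {u v : HilbertBasis ι ℂ K}

theorem IsSpectralDecomposition.basis_mem_eigenspan (hr : IsSpectralDecomposition ρ r u) (i : ι) :
    u i ∈ eigenspan ρ :=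
  Submodule.mem_iSup_of_mem (r i : ℂ) (Module.End.mem_eigenspace_iff.2 (hr.apply_basis i))

theorem IsSpectralDecomposition.finite_eigenvalue_eq (hr : IsSpectralDecomposition ρ r u) {l : ℂ}
    (hl : l ≠ 0) : {i | (r i : ℂ) = l}.Finite := by
  have h := hr.hasSum_one.summable.tendsto_cofinite_zero.norm.eventually_lt_const
    (u := ‖l‖) (by simpa using hl)
  refine (Filter.eventually_cofinite.1 h).subset fun i hi => ?_
  rw [Set.mem_ofPred_eq] at hi ⊢
  rw [← hi, Complex.norm_real]
  exact lt_irrefl _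

/-- For `α ≥ 1` no power `s j ^ (1 - α)` vanishes, so that the double sum is not zero. -/
theorem IsSpectralDecomposition.entropySum_ne_zero (hr : IsSpectralDecomposition ρ r u)
    (s : ι → ℝ) (v : HilbertBasis ι ℂ K) {α : ℝ} (hα : 1 ≤ α) :
    entropySum α r s u v ≠ 0 := by
  intro h0
  simp only [entropySum, ENNReal.tsum_eq_zero] at h0
  have hri : ∃ i, r i ≠ 0 := by
    by_contra! hall
    have h1 := hr.hasSum_one
    rw [funext hall] at h1
    exact zero_ne_one (hasSum_zero.unique h1)
  obtain ⟨i, hi⟩ := hri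
  have hzero : u i = 0 := by
    refine hilbertBasis_ext v fun j => ?_
    have h1 := h0 i j
    have hr0 : ENNReal.ofReal (r i) ^ α ≠ 0 :=
      (ENNReal.rpow_pos (ENNReal.ofReal_pos.2 (lt_of_le_of_ne (hr.nonneg i) hi.symm))
        ENNReal.ofReal_ne_top).ne'
    have hs0 : ENNReal.ofReal (s j) ^ (1 - α) ≠ 0 := by
      intro h2
      rcases ENNReal.rpow_eq_zero_iff.1 h2 with ⟨-, h3⟩ | ⟨h3, -⟩
      · linarith
      · exact ENNReal.ofReal_ne_top h3
    have h2 := (mul_eq_zero.1 h1).resolve_left (mul_ne_zero hr0 hs0)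
    rw [ENNReal.ofReal_eq_zero] at h2
    have h3 : ‖⟪u i, v j⟫_ℂ‖ = 0 := pow_eq_zero_iff two_ne_zero |>.1 (le_antisymm h2 (by positivity))
    rw [norm_inner_symm, norm_eq_zero] at h3
    rw [h3, inner_zero_right]
  have h1 := u.orthonormal.1 i
  rw [hzero, norm_zero] at h1
  exact zero_ne_one h1

variable [CompleteSpace K]

/-- The product `ρ ^ p X ρ ^ p` is defined on all eigenvectors of `ρ` as soon as `X` is defined on the
eigenvectors `u i` with nonzero eigenvalue: every nonzero eigenvalue has finite multiplicity. -/
theorem IsSpectralDecomposition.eigenspan_le_sandwich_domain_iff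
    (hr : IsSpectralDecomposition ρ r u) (hρ : ρ.IsPositive) {p : ℝ} (hp : 0 < p)
    (X : K →ₗ.[ℂ] K) :
    eigenspan ρ ≤ (sandwich (ρ ^ p) X).domain ↔ ∀ i, r i ≠ 0 → u i ∈ X.domain := by
  constructor
  · intro h i hi
    have h1 : (ρ ^ p) (u i) ∈ X.domain := h (hr.basis_mem_eigenspan i)
    rw [rpow_apply_of_eigenvector hρ hp.le (hr.apply_basis i)] at h1
    refine (X.domain.smul_mem_iff ?_).1 h1
    exact_mod_cast (Real.rpow_pos_of_pos (lt_of_le_of_ne (hr.nonneg i) hi.symm) p).ne'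
  · refine fun h => iSup_le fun l x hx => ?_
    change (ρ ^ p) x ∈ X.domain
    have hx' : ρ x = l • x := Module.End.mem_eigenspace_iff.1 hx
    have hcoord : ∀ i, (r i : ℂ) ≠ l → ⟪u i, x⟫_ℂ = 0 := by
      intro i hi
      have h1 := hr.inner_apply hρ i x
      rw [hx', inner_smul_right, eq_comm, ← sub_eq_zero, ← sub_mul, mul_eq_zero] at h1
      exact h1.resolve_left (sub_ne_zero.2 hi)
    rcases eq_or_ne l 0 with rfl | hl
    · have : (ρ ^ p) x = 0 := by
        refine hilbertBasis_ext u fun i => ?_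
        rw [hr.inner_rpow_apply hρ hp.le, inner_zero_right]
        rcases eq_or_ne (r i) 0 with hi | hi
        · rw [hi, Real.zero_rpow hp.ne']; simp
        · rw [hcoord i (by exact_mod_cast hi), mul_zero]
      rw [this]
      exact X.domain.zero_mem
    · have hsum : x = ∑ i ∈ (hr.finite_eigenvalue_eq hl).toFinset, ⟪u i, x⟫_ℂ • u i := by
        have h1 := u.hasSum_repr x
        simp only [u.repr_apply_apply] at h1
        refine h1.unique (hasSum_sum_of_ne_finset_zero fun i hi => ?_)
        rw [hcoord i (by simpa using hi), zero_smul]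
      rw [hsum, map_sum]
      refine Submodule.sum_mem _ fun i hi => ?_
      rw [map_smul, rpow_apply_of_eigenvector hρ hp.le (hr.apply_basis i)]
      refine Submodule.smul_mem _ _ (Submodule.smul_mem _ _ (h i ?_))
      intro h0
      have h1 : (r i : ℂ) = l := by simpa using hi
      rw [h0] at h1
      exact hl (by rw [← h1]; simp)

/-- The summands of `entropySum` with the convention `0 ^ p = ∞` for `p < 0` agree with those
for the real power when `u i` lies in the domain of `σ ^ p` for all `i` with `r i ≠ 0`. -/
theorem IsSpectralDecomposition.entropySum_term_eq
    (hr : IsSpectralDecomposition ρ r u) (hs : IsSpectralDecomposition σ s v)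
    (hσ : σ.IsPositive) {α p : ℝ} (hα : 0 < α) (hp : p ≠ 0)
    (h : ∀ i, r i ≠ 0 → u i ∈ (power σ p).domain) (i j : ι) :
    ENNReal.ofReal (r i) ^ α * ENNReal.ofReal (s j) ^ p * ENNReal.ofReal (‖⟪u i, v j⟫_ℂ‖ ^ 2) =
      ENNReal.ofReal (‖((s j ^ (p / 2) : ℝ) : ℂ) *
        (((r i ^ (α / 2) : ℝ) : ℂ) * ⟪u i, v j⟫_ℂ)‖ ^ 2) := by
  have hsq : ∀ {a t : ℝ}, 0 ≤ a → t ≠ 0 → a ^ t = ‖((a ^ (t / 2) : ℝ) : ℂ)‖ ^ 2 := by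
    intro a t ha ht
    rw [Complex.norm_real, Real.norm_of_nonneg (by positivity), sq,
      ← Real.rpow_add' ha (by simpa using ht), add_halves]
  rw [norm_mul, norm_mul, mul_pow, mul_pow, ← hsq (hs.nonneg j) hp, ← hsq (hr.nonneg i) hα.ne',
    ENNReal.ofReal_rpow_of_nonneg (hr.nonneg i) hα.le]
  rcases (hr.nonneg i).eq_or_lt with hi | hi
  · simp [← hi, Real.zero_rpow hα.ne']
  have hri := Real.rpow_nonneg hi.le α
  rcases (hs.nonneg j).eq_or_lt with hj | hj
  · rcases hp.lt_or_gt with hp' | hp'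
    · have h0 : ⟪u i, v j⟫_ℂ = 0 := by
        rw [← inner_conj_symm,
          hs.inner_eq_zero_of_mem_power_domain hσ hp' (h i hi.ne') hj.symm, map_zero]
      simp [h0]
    · simp [← hj, Real.zero_rpow hp, ENNReal.zero_rpow_of_pos hp']
  · rw [ENNReal.ofReal_rpow_of_pos hj, ← ENNReal.ofReal_mul hri,
      ← ENNReal.ofReal_mul (by positivity)]
    congr 1
    ring

/-- When `u i` lies in the domain of `σ ^ (1 - α)` for all `i` with `r i ≠ 0`, the operator
`ρ ^ (α / 2) σ ^ (1 - α) ρ ^ (α / 2)` is well defined and its trace is the double sum. With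
`A = σ ^ ((1 - α) / 2) ρ ^ (α / 2)` its quadratic form is `‖A x‖²`, and
`A* v_j = s_j ^ ((1 - α) / 2) ρ ^ (α / 2) v_j`. -/
theorem petzOperatorDefined_and_trace_eq (hρ : ρ.IsPositive) (hσ : σ.IsPositive)
    (hr : IsSpectralDecomposition ρ r u) (hs : IsSpectralDecomposition σ s v)
    {α : ℝ} (hα0 : 0 < α) (hα1 : α ≠ 1)
    (h : ∀ i, r i ≠ 0 → u i ∈ (power σ (1 - α)).domain) :
    PetzOperatorDefined ρ σ α ∧ trace (petzOperator ρ σ α) = entropySum α r s u v := by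
  have hp : 1 - α ≠ 0 := sub_ne_zero.2 hα1.symm
  have hα2 : 0 < α / 2 := half_pos hα0
  have hle := (hr.eigenspan_le_sandwich_domain_iff hρ hα2 (power σ (1 - α))).2 h
  obtain ⟨B, hB⟩ := hs.exists_sqrt_power hσ hp
  set T : K →ₗ.[ℂ] K :=
    (sandwich (ρ ^ (α / 2)) (power σ (1 - α))).domRestrict (eigenspan ρ) with hTdef
  let L : T.domain →ₗ[ℂ] (power σ (1 - α)).domain :=
    (((ρ ^ (α / 2) : K →L[ℂ] K) : K →ₗ[ℂ] K).domRestrict T.domain).codRestrict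
      (power σ (1 - α)).domain (fun x => x.2.2)
  have hL : ∀ x, ((L x : (power σ (1 - α)).domain) : K) = (ρ ^ (α / 2)) (x : K) := fun _ => rfl
  have hA : ∀ x y : T.domain, ⟪(x : K), T y⟫_ℂ = ⟪(B ∘ₗ L) x, (B ∘ₗ L) y⟫_ℂ := by
    intro x y
    have h1 : T y = (ρ ^ (α / 2)) (power σ (1 - α) (L y)) := rfl
    rw [h1, inner_rpow_apply_comm, ← hL]
    exact hs.inner_power_eq_inner_sqrt hσ hp hB (L x) (L y)
  have humem : ∀ i, u i ∈ T.domain := fun i =>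
    ⟨hr.basis_mem_eigenspan i, hle (hr.basis_mem_eigenspan i)⟩
  have hT : Dense (T.domain : Set K) := by
    have h1 : Dense (Submodule.span ℂ (Set.range u) : Set K) :=
      Submodule.dense_iff_topologicalClosure_eq_top.2 u.dense_span
    exact h1.mono (Submodule.span_le.2 (Set.range_subset_iff.2 humem))
  refine ⟨⟨hle, isPositiveSelfAdjoint_friedrichs hA hT⟩, ?_⟩
  have htr := trace_friedrichs_eq_tsum hA hT
    ⟨_, isOrthonormalBasisIn_range u fun i => domain_le_domain_friedrichs hA (humem i)⟩ v
    (fun j => ((s j ^ ((1 - α) / 2) : ℝ) : ℂ) • (ρ ^ (α / 2)) (v j)) (fun j x => by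
      rw [LinearMap.comp_apply, hB, hL, inner_rpow_apply_comm, inner_smul_left,
        Complex.conj_ofReal])
  rw [petzOperator, ← hTdef, htr, entropySum, ENNReal.tsum_comm]
  refine tsum_congr fun j => ?_
  rw [← tsum_ofReal_norm_inner_sq u]
  refine tsum_congr fun i => ?_
  rw [hr.entropySum_term_eq hs hσ hα0 hp h, inner_smul_right,
    hr.inner_rpow_apply hρ hα2.le]

theorem PetzOperatorDefined.mem_power_domain {α : ℝ} (hα0 : 0 < α) (hρ : ρ.IsPositive)
    (hr : IsSpectralDecomposition ρ r u) (h : PetzOperatorDefined ρ σ α) (i : ι) (hi : r i ≠ 0) :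
    u i ∈ (power σ (1 - α)).domain :=
  (hr.eigenspan_le_sandwich_domain_iff hρ (half_pos hα0) _).1 h.1 i hi

end Petz

theorem exists_real_eq_mul_log_iff {c : ℝ} (hc : c ≠ 0) (S : ℝ≥0∞) :
    (∃ x : ℝ, (c : EReal) * ENNReal.log S = (x : EReal)) ↔ S < ⊤ ∧ S ≠ 0 := by
  constructor
  · rintro ⟨x, hx⟩
    refine ⟨lt_top_iff_ne_top.2 ?_, ?_⟩
    · rintro rfl
      rw [ENNReal.log_top] at hx
      rcases hc.lt_or_gt with hc | hc
      · rw [EReal.coe_mul_top_of_neg hc] at hx; exact EReal.bot_ne_coe x hx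
      · rw [EReal.coe_mul_top_of_pos hc] at hx; exact EReal.top_ne_coe x hx
    · rintro rfl
      rw [ENNReal.log_zero] at hx
      rcases hc.lt_or_gt with hc | hc
      · rw [EReal.coe_mul_bot_of_neg hc] at hx; exact EReal.top_ne_coe x hx
      · rw [EReal.coe_mul_bot_of_pos hc] at hx; exact EReal.bot_ne_coe x hx
  · rintro ⟨h1, h2⟩
    exact ⟨c * Real.log S.toReal, by rw [ENNReal.log_pos_real h2 h1.ne, EReal.coe_mul]⟩

end PetzRenyi

theorem mainTheorem1 {K : Type*} [NormedAddCommGroup K] [InnerProductSpace ℂ K] [CompleteSpace K]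
    {ι : Type*} [Countable ι] (ρ σ : K →L[ℂ] K)
    (hρ : PetzRenyi.IsState ρ) (hσ : PetzRenyi.IsState σ)
    (r s : ι → ℝ) (u v : HilbertBasis ι ℂ K)
    (hr : PetzRenyi.IsSpectralDecomposition ρ r u)
    (hs : PetzRenyi.IsSpectralDecomposition σ s v)
    (α : ℝ) (hα0 : 0 < α) (hα1 : α ≠ 1) :
    -- membership in the domain of `σ ^ (1 - α)` in terms of the coefficients
    (∀ i, u i ∈ (PetzRenyi.power σ (1 - α)).domain ↔
      ∑' j, ENNReal.ofReal (s j) ^ (2 * (1 - α)) * ENNReal.ofReal (‖⟪u i, v j⟫_ℂ‖ ^ 2) < ⊤) ∧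
    -- finiteness
    ((∃ x : ℝ, PetzRenyi.relativeEntropy α ρ σ = (x : EReal)) ↔
      (∀ i, r i ≠ 0 → u i ∈ (PetzRenyi.power σ (1 - α)).domain) ∧
      PetzRenyi.entropySum α r s u v < ⊤ ∧ PetzRenyi.entropySum α r s u v ≠ 0) ∧
    -- for `α > 1` the sum cannot vanish
    (1 < α → (∀ i, r i ≠ 0 → u i ∈ (PetzRenyi.power σ (1 - α)).domain) →
      PetzRenyi.entropySum α r s u v ≠ 0) ∧
    -- the formula
    ((∀ i, r i ≠ 0 → u i ∈ (PetzRenyi.power σ (1 - α)).domain) →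
      PetzRenyi.relativeEntropy α ρ σ =
        (((α - 1)⁻¹ : ℝ) : EReal) * ENNReal.log (PetzRenyi.entropySum α r s u v)) := by
  have hp : 1 - α ≠ 0 := sub_ne_zero.2 hα1.symm
  have hent : (∀ i, r i ≠ 0 → u i ∈ (PetzRenyi.power σ (1 - α)).domain) →
      PetzRenyi.relativeEntropy α ρ σ =
        (((α - 1)⁻¹ : ℝ) : EReal) * ENNReal.log (PetzRenyi.entropySum α r s u v) := by
    intro h
    obtain ⟨h1, h2⟩ :=
      PetzRenyi.petzOperatorDefined_and_trace_eq hρ.1 hσ.1 hr hs hα0 hα1 h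
    rw [PetzRenyi.relativeEntropy, if_pos h1, h2]
  refine ⟨fun i => hs.mem_power_domain_iff hσ.1 hp (u i), ?_,
    fun h _ => hr.entropySum_ne_zero s v h.le, hent⟩
  by_cases h : ∀ i, r i ≠ 0 → u i ∈ (PetzRenyi.power σ (1 - α)).domain
  · rw [hent h, PetzRenyi.exists_real_eq_mul_log_iff (inv_ne_zero (sub_ne_zero.2 hα1))]
    exact (and_iff_right h).symm
  · refine iff_of_false ?_ fun h' => h h'.1
    rintro ⟨x, hx⟩
    rw [PetzRenyi.relativeEntropy,
      if_neg fun hd => h fun i hi => hd.mem_power_domain hα0 hρ.1 hr i hi] at hx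
    exact EReal.top_ne_coe x hx
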